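/- All graphs are finite, simple and undirected. A cover of a graph $G$ (with $\kappa$ colours) is a graph $H$ with vertex set $\bigcup_{v\in V(G)}X_v$, where $X_v=\{(v,1),\dots,(v,\kappa)\}$, whose edge set is $\bigcup_{uv\in E(G)}\mathscr M_{uv}$, where $\mathscr M_{uv}$ is a (possibly empty) matching between $X_u$ and $X_v$. A valued cover is a pair $(H,f)$ with $H$ a cover of $G$ and $f:V(H)\to\mathbb Z_{\ge 0}$; its kernel is the subgraph of $H$ induced by $\{x : f(x)\neq 0\}$. A graph $\Gamma$ is strictly $f$-degenerate if each nonempty subgraph $S$ of $\Gamma$ has a vertex $x$ with $\deg_S(x)<f(x)$. A strictly $f$-degenerate transversal of $H$ is a set $R\subseteq V(H)$ with $|R\cap X_v|=1$ for all $v\in V(G)$ such that $H[R]$ is strictly $f$-degenerate. A valued cover $(H,f)$ of $B$ is a building cover if $\sum_{q}f(v,q)=\deg_B(v)$ for all $v\in V(B)$ and at least one of the following holds: (i) the kernel is isomorphic to $B$; (ii) $B\cong K_p$ for some $p\ge 2$, the kernel is isomorphic to the disjoint union of $s$ copies of $K_p$ for some $s$, and $f$ is constant on each component of the kernel; (iii)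 $B$ is an odd cycle $C_n$, the kernel is isomorphic to the disjoint union of two copies of $C_n$, and $f\equiv 1$ on the kernel; (iv) $B$ is an even cycle $C_n$, the kernel is isomorphic to the graph on $\{1,\dots,n\}\times\{1,2\}$ with edges $(i,j)(i+1,j)$ for $1\le i<n$, $j=1,2$, and $(n,1)(1,2)$, $(n,2)(1,1)$, and $f\equiv 1$ on the kernel. The linear list vertex arboricity of $G$ is the least integer $k$ such that for every assignment of lists $L(v)$ with $|L(v)|\ge k$ there is a map $\phi$ on $V(G)$ with $\phi(v)\in L(v)$ for all $v$, each of whose colour classes induces a forest of maximum degree at most two. Theorem. Let $G$ be a connected graph with maximum degree $\Delta$. (a) Suppose $\Delta\ge 3$. Let $H$ be a cover of $G$ and let $f:V(H)\to\{0,1,\dots,\Delta-1\}$ satisfy $\sum_{q=1}^{\kappa}f(v,q)\ge\Delta$ for each $v\in V(G)$. Unless $G=K_{\Delta+1}$ and $(H,f)$ is a building cover, $H$ has a strictly $f$-degenerate transversal. (b) If $G$ is neither a complete graph of odd order nor a cycle, then the linear list vertex arboricity of $G$ is at most $\lceil\Delta/2\rceil$. -/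

import Mathlib

namespace CoverDegeneracy

open SimpleGraph

/-- `H` is a cover of `G`, with fibres `X_v = {v} × Fin κ`: the edges of `H` lie over edges of `G`,
and for every edge `uv` of `G` the edges of `H` between `X_u` and `X_v` form a (possibly empty)
matching. -/
structure IsCover {V : Type*} {κ : ℕ} (G : SimpleGraph V) (H : SimpleGraph (V × Fin κ)) :
    Prop where
  adj_base : ∀ x y, H.Adj x y → G.Adj x.1 y.1
  matching : ∀ x y z, H.Adj x y → H.Adj x z → y.1 = z.1 → y = z

/-- A graph is strictly `f`-degenerate if every nonempty subgraph `S` has a vertex `v` with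
`deg_S v < f v`. -/
def StrictlyDegenerate {W : Type*} (Γ : SimpleGraph W) (f : W → ℕ) : Prop :=
  ∀ S : Γ.Subgraph, S.verts.Nonempty → ∃ v ∈ S.verts, (S.neighborSet v).encard < f v

/-- `R` meets every fibre `X_v` in exactly one vertex. -/
def IsTransversal {V : Type*} {κ : ℕ} (R : Set (V × Fin κ)) : Prop :=
  ∀ v, ∃! q : Fin κ, (v, q) ∈ R

/-- `R` is a transversal and `H[R]` is strictly `f`-degenerate. -/
def IsStrictlyDegenerateTransversal {V : Type*} {κ : ℕ} (H : SimpleGraph (V × Fin κ))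
    (f : V × Fin κ → ℕ) (R : Set (V × Fin κ)) : Prop :=
  IsTransversal R ∧ StrictlyDegenerate (H.induce R) (fun x => f x.1)

/-- The kernel of a valued cover: delete every vertex at which `f` vanishes. -/
def kernel {V : Type*} {κ : ℕ} (H : SimpleGraph (V × Fin κ)) (f : V × Fin κ → ℕ) :
    SimpleGraph {x : V × Fin κ | f x ≠ 0} :=
  H.induce {x | f x ≠ 0}

/-- The graph consisting of `s` disjoint copies of `K_p`: the Cartesian product of `K_p` and an
independent set with `s` vertices. -/
def completeTilde (p s : ℕ) : SimpleGraph (Fin p × Fin s) :=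
  completeGraph (Fin p) □ (⊥ : SimpleGraph (Fin s))

/-- The circular ladder graph: the Cartesian product of the cycle `C_n` and an independent set
with two vertices. -/
def circularLadder (n : ℕ) : SimpleGraph (Fin n × Fin 2) :=
  cycleGraph n □ (⊥ : SimpleGraph (Fin 2))

/-- The Möbius ladder: two disjoint paths on `n` vertices, with the last vertex of each path joined
to the first vertex of the other one. -/
def mobiusLadder (n : ℕ) : SimpleGraph (Fin n × Fin 2) :=
  SimpleGraph.fromRel fun a b =>
    ((a.1 : ℕ) + 1 = b.1 ∧ a.2 = b.2) ∨ ((a.1 : ℕ) + 1 = n ∧ (b.1 : ℕ) = 0 ∧ a.2 ≠ b.2)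

/-- The valued cover `(H, f)` of `B` is a building cover: the values of `f` on each fibre add up to
the degree, and one of the four listed configurations occurs. The number `s` of colours in the
kernel may be smaller than `κ`. -/
def IsBuildingCover {V : Type*} [Fintype V] {κ : ℕ} (B : SimpleGraph V) [DecidableRel B.Adj]
    (H : SimpleGraph (V × Fin κ)) (f : V × Fin κ → ℕ) : Prop :=
  IsCover B H ∧
  (∀ v, ∑ q, f (v, q) = B.degree v) ∧
  (Nonempty (kernel H f ≃g B) ∨
    (∃ p s : ℕ, 2 ≤ p ∧ Nonempty (B ≃g completeGraph (Fin p)) ∧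
      Nonempty (kernel H f ≃g completeTilde p s) ∧
      ∀ x y, (kernel H f).Reachable x y → f x.1 = f y.1) ∨
    (∃ n : ℕ, 3 ≤ n ∧ Odd n ∧ Nonempty (B ≃g cycleGraph n) ∧
      Nonempty (kernel H f ≃g circularLadder n) ∧ ∀ x, f x ≠ 0 → f x = 1) ∨
    (∃ n : ℕ, 3 ≤ n ∧ Even n ∧ Nonempty (B ≃g cycleGraph n) ∧
      Nonempty (kernel H f ≃g mobiusLadder n) ∧ ∀ x, f x ≠ 0 → f x = 1))

/-- Every colour class of `φ` induces a forest of maximum degree at most two. -/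
def IsLinearForestedColoring {V : Type*} (G : SimpleGraph V) (φ : V → ℕ) : Prop :=
  ∀ c : ℕ, (G.induce {v | φ v = c}).IsAcyclic ∧
    ∀ v, ((G.induce {v | φ v = c}).neighborSet v).encard ≤ 2

/-- From any lists of at least `k` colours one can choose a colouring all of whose colour classes
induce linear forests. -/
def LinearListForestedColorable {V : Type*} (G : SimpleGraph V) (k : ℕ) : Prop :=
  ∀ L : V → Finset ℕ, (∀ v, k ≤ (L v).card) →
    ∃ φ : V → ℕ, (∀ v, φ v ∈ L v) ∧ IsLinearForestedColoring G φ

/-- The linear list vertex arboricity: the least `k` such that the above holds (`⊤` if there is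
none). -/
noncomputable def linearListVertexArboricity {V : Type*} (G : SimpleGraph V) : ℕ∞ :=
  ⨅ (k : ℕ) (_ : LinearListForestedColorable G k), (k : ℕ∞)

end CoverDegeneracy

namespace CoverDegeneracy

open SimpleGraph

set_option linter.unusedSectionVars false

/-! Part (a) supposes that no strictly degenerate transversal exists (`Stuck`) and pushes a hole
around the graph. Colouring greedily towards `v` gives a degenerate partial transversal missing only
`v`. Since it cannot be completed, all inequalities in the count at `v` are tight: `G` is
`D`-regular, each colour `c` of `v` has exactly `f (v, c)` coloured neighbours, and each neighbour
of `v` is seen by exactly one colour of `v` (`Stuck.holed_facts`). Giving `v` the colour that sees a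
neighbour `u`, and uncolouring `u`, moves the hole to `u` (`Stuck.slide`).

Moving the hole around a cycle `v, y, x, …, z, v` in which `v` has no neighbours but `y` and `z`
exchanges the colours of `v` seeing `y` and `z`, and the new colour of `y` depends only on the old
colour of `x` (`Stuck.rotate`). If `G` is not complete, some non-cut vertex `v` has two neighbours
on such a cycle of length at least four (`exists_attached_of_regular`). Comparing rotations shows
that a single colour `c` of `v` sees all neighbours of `v`, so `f (v, c) = D`, against `f < D`
(`Stuck.false_of_attached`). If `G` is complete, rotations around triangles make adjacency
transitive on the kernel, which is therefore a union of disjoint cliques with `f` constant on each: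
a building cover.

For part (b) with `Δ ≥ 3`, apply (a) to the cover whose edges join equal colours, with `f = 2` on
the lists and `0` elsewhere. Strict degeneracy then means that colour classes are forests, and a
transversal with fewest edges has maximum degree at most two. The exceptional building covers force
a complete graph of odd order. For `Δ ≤ 2` the graph is itself a linear forest. -/

theorem exists_adj_dist_lt {V : Type*} {G : SimpleGraph V} (hG : G.Connected) {v w : V} (h : w ≠ v) :
    ∃ u, G.Adj w u ∧ G.dist u v < G.dist w v := by
  obtain ⟨p, hp⟩ := hG.exists_walk_length_eq_dist w v
  cases p with
  | nil => exact absurd rfl h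
  | cons huv q =>
    refine ⟨_, huv, ?_⟩
    have := dist_le q
    rw [Walk.length_cons] at hp
    omega

/-! ### Partial transversals with one hole, and moving the hole. -/

section Transversals

variable {V : Type*} [Fintype V] [DecidableEq V] {κ : ℕ} {G : SimpleGraph V}
  {H : SimpleGraph (V × Fin κ)} {f : V × Fin κ → ℕ} {D : ℕ}

open Classical in
/-- The vertices of `T` whose colour under `φ` is a neighbour of `x` in the cover. -/
noncomputable def colorNbrs (H : SimpleGraph (V × Fin κ)) (φ : V → Fin κ) (T : Finset V)
    (x : V × Fin κ) : Finset V :=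
  T.filter fun w => H.Adj x (w, φ w)

/-- The graph spanned in the cover by the colours of `φ` on `T` is strictly `f`-degenerate. -/
def DegenerateOn (H : SimpleGraph (V × Fin κ)) (f : V × Fin κ → ℕ) (T : Finset V)
    (φ : V → Fin κ) : Prop :=
  ∀ S ⊆ T, S.Nonempty → ∃ u ∈ S, (colorNbrs H φ S (u, φ u)).card < f (u, φ u)

/-- `φ` is a strictly degenerate partial transversal that omits exactly `v`. -/
def Holed (H : SimpleGraph (V × Fin κ)) (f : V × Fin κ → ℕ) (v : V) (φ : V → Fin κ) : Prop :=
  DegenerateOn H f (Finset.univ.erase v) φ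

theorem mem_colorNbrs {φ : V → Fin κ} {T : Finset V} {x : V × Fin κ} {w : V} :
    w ∈ colorNbrs H φ T x ↔ w ∈ T ∧ H.Adj x (w, φ w) := by
  simp [colorNbrs]

theorem colorNbrs_mono {φ : V → Fin κ} {S T : Finset V} (h : S ⊆ T) (x : V × Fin κ) :
    colorNbrs H φ S x ⊆ colorNbrs H φ T x := fun w hw => by
  rw [mem_colorNbrs] at *
  exact ⟨h hw.1, hw.2⟩

theorem colorNbrs_congr {φ ψ : V → Fin κ} {T : Finset V} (h : ∀ w ∈ T, ψ w = φ w)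
    (x : V × Fin κ) : colorNbrs H ψ T x = colorNbrs H φ T x := by
  ext w
  rw [mem_colorNbrs, mem_colorNbrs]
  exact and_congr_right fun hw => by rw [h w hw]

theorem DegenerateOn.mono {φ : V → Fin κ} {S T : Finset V} (hT : DegenerateOn H f T φ)
    (h : S ⊆ T) : DegenerateOn H f S φ := fun U hU => hT U (hU.trans h)

theorem DegenerateOn.congr {φ ψ : V → Fin κ} {T : Finset V} (hT : DegenerateOn H f T φ)
    (h : ∀ w ∈ T, ψ w = φ w) : DegenerateOn H f T ψ := fun S hS hne => by
  obtain ⟨u, hu, hlt⟩ := hT S hS hne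
  refine ⟨u, hu, ?_⟩
  rwa [colorNbrs_congr (fun w hw => h w (hS hw)), h u (hS hu)]

theorem DegenerateOn.pos {φ : V → Fin κ} {T : Finset V} (hT : DegenerateOn H f T φ) {u : V}
    (hu : u ∈ T) : 0 < f (u, φ u) := by
  obtain ⟨w, hw, hlt⟩ := hT {u} (by simpa using hu) (by simp)
  rw [Finset.mem_singleton] at hw
  subst hw
  omega

theorem DegenerateOn.insert {φ : V → Fin κ} {T : Finset V} (hT : DegenerateOn H f T φ) {v : V}
    (hv : (colorNbrs H φ (Insert.insert v T) (v, φ v)).card < f (v, φ v)) :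
    DegenerateOn H f (Insert.insert v T) φ := fun S hS hne => by
  by_cases hvS : v ∈ S
  · exact ⟨v, hvS, (Finset.card_le_card (colorNbrs_mono hS _)).trans_lt hv⟩
  · exact hT S (fun w hw => (Finset.mem_insert.1 (hS hw)).resolve_left
      (fun h => hvS (h ▸ hw))) hne

/-- A counterexample: a cover without strictly `f`-degenerate transversal, although the values of
`f` on each fibre add up to at least an upper bound for the degrees. -/
structure Stuck (G : SimpleGraph V) (H : SimpleGraph (V × Fin κ)) (f : V × Fin κ → ℕ) (D : ℕ) :
    Prop where
  pos : 0 < D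
  cover : IsCover G H
  connected : G.Connected
  ncard_le : ∀ v, (G.neighborSet v).ncard ≤ D
  le_sum : ∀ v, D ≤ ∑ q, f (v, q)
  not_degenerate : ∀ φ, ¬ DegenerateOn H f Finset.univ φ

theorem IsCover.fst_ne (hc : IsCover G H) {x y : V × Fin κ} (h : H.Adj x y) : x.1 ≠ y.1 :=
  (hc.adj_base x y h).ne

theorem IsCover.unique (hc : IsCover G H) {x : V × Fin κ} {v : V} {c d : Fin κ}
    (h : H.Adj (v, c) x) (h' : H.Adj (v, d) x) : c = d := by
  have := hc.matching x (v, c) (v, d) h.symm h'.symm rfl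
  simpa using this

-- Fibres are joined by matchings, so a coloured neighbour of `v` is counted for at most one colour
-- of `v`.
open Classical in
theorem sum_card_colorNbrs_le (hc : IsCover G H) (φ : V → Fin κ) (T : Finset V) (v : V) :
    ∑ c, (colorNbrs H φ T (v, c)).card ≤ (T.filter fun w => w ∈ G.neighborSet v).card := by
  rw [← Finset.card_biUnion]
  · refine Finset.card_le_card fun w hw => ?_
    simp only [Finset.mem_biUnion, mem_colorNbrs] at hw
    obtain ⟨c, -, hw, h⟩ := hw
    exact Finset.mem_filter.2 ⟨hw, hc.adj_base _ _ h⟩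
  · intro c _ d _ hcd
    refine Finset.disjoint_left.2 fun w hw hw' => hcd ?_
    rw [mem_colorNbrs] at hw hw'
    exact hc.unique hw.2 hw'.2

/-- Greedy colouring in order of decreasing distance to `v`: when `a` is coloured, a neighbour
nearer to `v` is still uncoloured, so fewer than `D` neighbours block and some colour of `a` has
slack. -/
theorem Stuck.exists_holed (hs : Stuck G H f D) (v : V) : ∃ φ, Holed H f v φ := by
  classical
  have key : ∀ T : Finset V, v ∉ T → ∃ φ, DegenerateOn H f T φ := by
    intro T
    induction T using Finset.induction_on_min_value (fun u => G.dist u v) with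
    | empty =>
      intro _
      obtain ⟨c, -, -⟩ := Finset.exists_ne_zero_of_sum_ne_zero
        (hs.pos.trans_le (hs.le_sum v)).ne'
      exact ⟨fun _ => c, fun S hS hne => absurd (Finset.subset_empty.1 hS) hne.ne_empty⟩
    | insert a T haT hmin ih =>
      intro hv
      rw [Finset.mem_insert, not_or] at hv
      obtain ⟨φ, hφ⟩ := ih hv.2
      obtain ⟨u, hau, hu⟩ := exists_adj_dist_lt hs.connected (Ne.symm hv.1)
      have huT : u ∉ T := fun h => absurd (hmin u h) (by omega)
      have hlt : ∑ c, (colorNbrs H φ (Insert.insert a T) (a, c)).card < ∑ c, f (a, c) := by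
        refine lt_of_lt_of_le ?_ ((hs.ncard_le a).trans (hs.le_sum a))
        refine (sum_card_colorNbrs_le hs.cover φ _ a).trans_lt ?_
        rw [← Set.ncard_coe_finset]
        refine Set.ncard_lt_ncard ?_ (Set.toFinite _)
        refine ⟨fun w hw => by simpa using (Finset.mem_filter.1 hw).2, fun h => ?_⟩
        have := (Finset.mem_filter.1 (h (show u ∈ G.neighborSet a from hau))).1
        rw [Finset.mem_insert] at this
        exact this.elim hau.ne' huT
      obtain ⟨c, -, hclt⟩ := Finset.exists_lt_of_sum_lt hlt
      refine ⟨Function.update φ a c, DegenerateOn.insert (hφ.congr fun w hw => ?_) ?_⟩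
      · exact Function.update_of_ne (ne_of_mem_of_not_mem hw haT) _ _
      · rw [Function.update_self]
        refine lt_of_le_of_lt (Finset.card_le_card fun w hw => ?_) hclt
        rw [mem_colorNbrs] at hw ⊢
        have := hs.cover.fst_ne hw.2
        rwa [Function.update_of_ne this.symm] at hw
  exact key _ (Finset.notMem_erase v _)

/-- Fibres are independent, so the irrelevant value that a holed colouring takes at its hole never
enters the counts there. -/
theorem colorNbrs_update (hc : IsCover G H) (φ : V → Fin κ) (T : Finset V) (v : V)
    (c d : Fin κ) : colorNbrs H (Function.update φ v d) T (v, c) = colorNbrs H φ T (v, c) := by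
  ext w
  rw [mem_colorNbrs, mem_colorNbrs]
  refine and_congr_right fun _ => ?_
  by_cases h : w = v
  · subst h
    exact ⟨fun h => (hc.fst_ne h rfl).elim, fun h => (hc.fst_ne h rfl).elim⟩
  · rw [Function.update_of_ne h]

theorem Holed.degenerateOn_update (hc : IsCover G H) {v : V} {φ : V → Fin κ}
    (hφ : Holed H f v φ) {c : Fin κ} (h : (colorNbrs H φ Finset.univ (v, c)).card < f (v, c)) :
    DegenerateOn H f Finset.univ (Function.update φ v c) := by
  rw [← Finset.insert_erase (Finset.mem_univ v)]
  refine DegenerateOn.insert (DegenerateOn.congr hφ fun w hw => ?_) ?_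
  · exact Function.update_of_ne (Finset.ne_of_mem_erase hw) _ _
  · rwa [Function.update_self, colorNbrs_update hc, Finset.insert_erase (Finset.mem_univ v)]

/-- A colour with fewer than `f (v, c)` coloured neighbours would fill the hole. Hence `D ≤ ∑ f ≤ ∑
counts ≤ deg v ≤ D`, with equality throughout. -/
theorem Stuck.holed_facts (hs : Stuck G H f D) {v : V} {φ : V → Fin κ} (hφ : Holed H f v φ) :
    (∀ c, (colorNbrs H φ Finset.univ (v, c)).card = f (v, c)) ∧
    (∀ w, G.Adj v w → ∃ c, H.Adj (v, c) (w, φ w)) ∧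
    ∑ c, f (v, c) = D ∧ (G.neighborSet v).ncard = D := by
  classical
  have h1 : ∀ c, f (v, c) ≤ (colorNbrs H φ Finset.univ (v, c)).card := fun c =>
    not_lt.1 fun h => hs.not_degenerate _ (hφ.degenerateOn_update hs.cover h)
  have h2 := Finset.sum_le_sum fun c (_ : c ∈ Finset.univ) => h1 c
  have h3 := sum_card_colorNbrs_le hs.cover φ Finset.univ v
  have h4 : (Finset.univ.filter fun w => w ∈ G.neighborSet v).card = (G.neighborSet v).ncard := by
    rw [← Set.ncard_coe_finset]
    congr 1
    ext w
    simp
  have h5 := hs.ncard_le v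
  have h6 := hs.le_sum v
  have h7 : ∑ c, f (v, c) = ∑ c, (colorNbrs H φ Finset.univ (v, c)).card := by omega
  refine ⟨fun c => ?_, fun w hw => ?_, by omega, by omega⟩
  · exact ((Finset.sum_eq_sum_iff_of_le fun c _ => h1 c).1 h7 c (Finset.mem_univ c)).symm
  · by_contra hno
    push Not at hno
    have hsub : Finset.univ.biUnion (fun c => colorNbrs H φ Finset.univ (v, c)) ⊆
        (Finset.univ.filter fun w => w ∈ G.neighborSet v).erase w := fun u hu => by
      simp only [Finset.mem_biUnion, mem_colorNbrs] at hu
      obtain ⟨c, -, -, h⟩ := hu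
      refine Finset.mem_erase.2 ⟨fun huw => hno c (huw ▸ h), ?_⟩
      exact Finset.mem_filter.2 ⟨Finset.mem_univ _, hs.cover.adj_base _ _ h⟩
    have h8 := Finset.card_le_card hsub
    rw [Finset.card_biUnion, Finset.card_erase_of_mem (by simpa using hw)] at h8
    · have : 0 < (Finset.univ.filter fun w => w ∈ G.neighborSet v).card :=
        Finset.card_pos.2 ⟨w, by simpa using hw⟩
      omega
    · intro c _ d _ hcd
      refine Finset.disjoint_left.2 fun w hw hw' => hcd ?_
      rw [mem_colorNbrs] at hw hw'
      exact hs.cover.unique hw.2 hw'.2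

/-- The count for `c` is exactly `f (v, c)`, and uncolouring the neighbour `u` lowers it by one, so
`v` can be added with colour `c`. -/
theorem Stuck.slide (hs : Stuck G H f D) {v u : V} {φ : V → Fin κ} (hφ : Holed H f v φ)
    {c : Fin κ} (hc : H.Adj (v, c) (u, φ u)) : Holed H f u (Function.update φ v c) := by
  have hvu : v ≠ u := hs.cover.fst_ne hc
  have : Finset.univ.erase u = Insert.insert v ((Finset.univ.erase u).erase v) :=
    (Finset.insert_erase (by simp [hvu])).symm
  rw [Holed, this]
  refine DegenerateOn.insert (DegenerateOn.congr (DegenerateOn.mono hφ ?_) fun w hw => ?_) ?_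
  · intro w hw
    simp only [Finset.mem_erase] at hw ⊢
    exact ⟨hw.1, hw.2.2⟩
  · exact Function.update_of_ne (Finset.ne_of_mem_erase hw) _ _
  · rw [Function.update_self, colorNbrs_update hs.cover, ← this, ← (hs.holed_facts hφ).1 c]
    refine Finset.card_lt_card ⟨colorNbrs_mono (Finset.subset_univ _) _, fun h => ?_⟩
    have := h (mem_colorNbrs.2 ⟨Finset.mem_univ u, hc⟩)
    rw [mem_colorNbrs] at this
    simp at this

theorem Stuck.slide_walk (hs : Stuck G H f D) {v u : V} (W : G.Walk v u) :
    ∀ {φ : V → Fin κ}, Holed H f v φ →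
      ∃ ψ, Holed H f u ψ ∧ ∀ t, t ∉ W.support → ψ t = φ t := by
  induction W with
  | nil => exact fun {φ} hφ => ⟨φ, hφ, fun _ _ => rfl⟩
  | cons h W ih =>
    intro φ hφ
    obtain ⟨c, hc⟩ := (hs.holed_facts hφ).2.1 _ h
    obtain ⟨ψ, hψ, hψ'⟩ := ih (hs.slide hφ hc)
    refine ⟨ψ, hψ, fun t ht => ?_⟩
    rw [Walk.support_cons, List.mem_cons, not_or] at ht
    rw [hψ' t ht.2, Function.update_of_ne ht.1]

/-- The hole travels once around the cycle `v, y, x, …, z, v`. On the way `y` receives the colour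
matched to `φ x`, and `z` finally receives one seen by the colour `a` that used to see `y`. Among
the neighbours of `v` only `y` and `z` change, so the counts at `v` force the other half of the
exchange. -/
theorem Stuck.rotate (hs : Stuck G H f D) {v y x z : V} {φ : V → Fin κ} (hφ : Holed H f v φ)
    (hvy : G.Adj v y) (hyx : G.Adj y x) (W : G.Walk x z) (hvz : G.Adj v z)
    (hW : ∀ t ∈ W.support, t ≠ v ∧ t ≠ y ∧ (G.Adj v t → t = z)) :
    ∃ ψ, Holed H f v ψ ∧ (∀ t, t ≠ v → t ≠ y → t ∉ W.support → ψ t = φ t) ∧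
      H.Adj (y, ψ y) (x, φ x) ∧
      (∀ c, H.Adj (v, c) (z, ψ z) ↔ H.Adj (v, c) (y, φ y)) ∧
      (∀ c, H.Adj (v, c) (y, ψ y) ↔ H.Adj (v, c) (z, φ z)) := by
  have hx := hW x W.start_mem_support
  have hz := hW z W.end_mem_support
  have hcov := hs.cover
  obtain ⟨a, ha⟩ := (hs.holed_facts hφ).2.1 y hvy
  obtain ⟨b, hb⟩ := (hs.holed_facts hφ).2.1 z hvz
  have hφ1 := hs.slide hφ ha
  obtain ⟨d, hd⟩ := (hs.holed_facts hφ1).2.1 x hyx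
  have hφ2 := hs.slide hφ1 hd
  obtain ⟨φ3, hφ3, hφ3'⟩ := hs.slide_walk W hφ2
  have e1 : φ3 v = a := by
    rw [hφ3' v fun h => (hW v h).1 rfl, Function.update_of_ne hvy.ne, Function.update_self]
  have e2 : φ3 y = d := by
    rw [hφ3' y fun h => (hW y h).2.1 rfl, Function.update_self]
  have e3 : ∀ t, t ≠ v → t ≠ y → t ∉ W.support → φ3 t = φ t := fun t h1 h2 h3 => by
    rw [hφ3' t h3, Function.update_of_ne h2, Function.update_of_ne h1]
  obtain ⟨g, hg⟩ := (hs.holed_facts hφ3).2.1 v hvz.symm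
  have hψ := hs.slide hφ3 hg
  rw [Function.update_of_ne hx.1] at hd
  rw [e1] at hg
  set ψ := Function.update φ3 z g with hψdef
  have p1 : ∀ t, t ≠ v → t ≠ y → t ∉ W.support → ψ t = φ t := fun t h1 h2 h3 => by
    rw [hψdef, Function.update_of_ne (ne_of_mem_of_not_mem W.end_mem_support h3).symm, e3 t h1 h2 h3]
  have p2 : ψ y = d := by rw [hψdef, Function.update_of_ne hz.2.1.symm, e2]
  have p3 : H.Adj (v, a) (z, ψ z) := by rw [hψdef, Function.update_self]; exact hg.symm
  obtain ⟨e, he⟩ := (hs.holed_facts hψ).2.1 y hvy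
  -- Otherwise the neighbours of `(v, b)` can only shrink from `φ` to `ψ`. Both sets have `f (v, b)`
  -- elements, so they agree; yet `y` is lost if `a = b`, and `z` if `a ≠ b`.
  have heb : e = b := by
    by_contra hne
    have hsub : colorNbrs H ψ Finset.univ (v, b) ⊆ colorNbrs H φ Finset.univ (v, b) := by
      intro t ht
      rw [mem_colorNbrs] at ht ⊢
      refine ⟨Finset.mem_univ t, ?_⟩
      have hty : t ≠ y := fun h => hne (hcov.unique (h ▸ he) ht.2)
      by_cases htz : t = z
      · exact htz ▸ hb
      · have hvt := hcov.adj_base _ _ ht.2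
        rw [← p1 t hvt.ne' hty fun h => htz ((hW t h).2.2 hvt)]
        exact ht.2
    have hcard := ((hs.holed_facts hψ).1 b).trans ((hs.holed_facts hφ).1 b).symm
    have heq := Finset.eq_of_subset_of_card_le hsub hcard.ge
    by_cases hab : a = b
    · have : y ∈ colorNbrs H φ Finset.univ (v, b) :=
        mem_colorNbrs.2 ⟨Finset.mem_univ _, hab ▸ ha⟩
      rw [← heq, mem_colorNbrs] at this
      exact hne (hcov.unique he this.2)
    · have : z ∈ colorNbrs H φ Finset.univ (v, b) := mem_colorNbrs.2 ⟨Finset.mem_univ _, hb⟩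
      rw [← heq, mem_colorNbrs] at this
      exact hab (hcov.unique p3 this.2)
  subst heb
  refine ⟨ψ, hψ, p1, p2 ▸ hd, fun c => ?_, fun c => ?_⟩
  · exact ⟨fun h => hcov.unique p3 h ▸ ha, fun h => hcov.unique ha h ▸ p3⟩
  · exact ⟨fun h => hcov.unique he h ▸ hb, fun h => hcov.unique hb h ▸ he⟩

end Transversals

/-! ### Components outside a closed neighbourhood and their attachments. -/

section Links

variable {V : Type*} {G : SimpleGraph V}

/-- `x` and `x'` are joined by a walk that avoids the closed neighbourhood of `v`. -/
def JoinedOutside (G : SimpleGraph V) (v x x' : V) : Prop :=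
  ∃ W : G.Walk x x', ∀ t ∈ W.support, t ≠ v ∧ ¬ G.Adj v t

/-- `y` and `z` are attached to a common component of the complement of the closed
neighbourhood of `v`. -/
def Attached (G : SimpleGraph V) (v y z : V) : Prop :=
  ∃ x x', G.Adj y x ∧ JoinedOutside G v x x' ∧ G.Adj x' z

theorem JoinedOutside.refl {v x : V} (h : x ≠ v) (h' : ¬ G.Adj v x) : JoinedOutside G v x x :=
  ⟨Walk.nil, fun t ht => by
    rw [Walk.support_nil, List.mem_singleton] at ht
    exact ht ▸ ⟨h, h'⟩⟩

theorem JoinedOutside.symm {v x x' : V} (h : JoinedOutside G v x x') :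
    JoinedOutside G v x' x := by
  obtain ⟨W, hW⟩ := h
  exact ⟨W.reverse, fun t ht => hW t (by simpa using ht)⟩

theorem JoinedOutside.trans {v x y z : V} (h : JoinedOutside G v x y)
    (h' : JoinedOutside G v y z) : JoinedOutside G v x z := by
  obtain ⟨W, hW⟩ := h
  obtain ⟨W', hW'⟩ := h'
  exact ⟨W.append W', fun t ht => ((Walk.mem_support_append_iff _ _).1 ht).elim (hW t) (hW' t)⟩

theorem JoinedOutside.not_adj_right {v x y : V} (h : JoinedOutside G v x y) :
    y ≠ v ∧ ¬ G.Adj v y := by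
  obtain ⟨W, hW⟩ := h
  exact hW _ W.end_mem_support

theorem JoinedOutside.step {v x y z : V} (h : JoinedOutside G v x y) (hyz : G.Adj y z)
    (hz : z ≠ v) (hz' : ¬ G.Adj v z) : JoinedOutside G v x z :=
  h.trans ⟨hyz.toWalk, fun t ht => by
    simp only [Walk.support_cons, Walk.support_nil, List.mem_cons, List.not_mem_nil,
      or_false] at ht
    rcases ht with rfl | rfl
    exacts [h.not_adj_right, ⟨hz, hz'⟩]⟩

theorem JoinedOutside.of_mem_support [DecidableEq V] {v x y : V} {W : G.Walk x y}
    (hW : ∀ t ∈ W.support, t ≠ v ∧ ¬ G.Adj v t) {t : V} (ht : t ∈ W.support) :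
    JoinedOutside G v x t :=
  ⟨W.takeUntil t ht, fun u hu => hW u (Walk.support_takeUntil_subset_support _ _ hu)⟩

theorem Attached.symm {v y z : V} (h : Attached G v y z) : Attached G v z y := by
  obtain ⟨x, x', h1, h2, h3⟩ := h
  exact ⟨x', x, h3.symm, h2.symm, h1.symm⟩

/-- A property of neighbours of `v` that spreads along edges and along common attachments holds
for all neighbours of `v` as soon as it holds for one and `v` is not a cut vertex. -/
theorem forall_adj_of_linked {v : V}
    (hcon : ∀ u w, u ≠ v → w ≠ v → ∃ W : G.Walk u w, v ∉ W.support)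
    (P : V → Prop) (hstep : ∀ y z, G.Adj v y → G.Adj v z → y ≠ z → P y →
      (G.Adj y z ∨ Attached G v y z) → P z)
    {y : V} (hy : G.Adj v y) (hPy : P y) {z : V} (hz : G.Adj v z) : P z := by
  by_contra hPz
  obtain ⟨W, hW⟩ := hcon y z hy.ne' hz.ne'
  -- The set consists of the neighbours of `v` with `P` and the outside components attached to them;
  -- a walk avoiding `v` cannot leave it.
  obtain ⟨d, hd, h1, h2⟩ := W.exists_boundary_dart
    {u | (G.Adj v u ∧ P u) ∨ (∃ w x, G.Adj v w ∧ P w ∧ G.Adj w x ∧ JoinedOutside G v x u)}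
    (Or.inl ⟨hy, hPy⟩) (by
      rintro (h | ⟨w, x, -, -, -, h⟩)
      · exact hPz h.2
      · exact h.not_adj_right.2 hz)
  have hdv : d.snd ≠ v := fun h => hW (h ▸ W.dart_snd_mem_support_of_mem_darts hd)
  refine h2 ?_
  by_cases had : G.Adj v d.snd
  · left
    refine ⟨had, ?_⟩
    rcases h1 with ⟨ha, hP⟩ | ⟨w, x, hw, hP, hwx, hj⟩
    · exact hstep _ _ ha had d.adj.ne hP (Or.inl d.adj)
    · by_cases hwd : w = d.snd
      · exact hwd ▸ hP
      · exact hstep _ _ hw had hwd hP (Or.inr ⟨x, _, hwx, hj, d.adj⟩)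
  · right
    rcases h1 with ⟨ha, hP⟩ | ⟨w, x, hw, hP, hwx, hj⟩
    · exact ⟨_, _, ha, hP, d.adj, JoinedOutside.refl hdv had⟩
    · exact ⟨w, x, hw, hP, hwx, hj.step d.adj hdv had⟩

end Links

/-! ### All neighbours of a non-cut hole are seen by the same colour. -/

section LocalColors

variable {V : Type*} [Fintype V] [DecidableEq V] {κ : ℕ} {G : SimpleGraph V}
  {H : SimpleGraph (V × Fin κ)} {f : V × Fin κ → ℕ} {D : ℕ}

/-- The colours of `y` and `z` have the same neighbours in the fibre of `v`. -/
def SameSeen (H : SimpleGraph (V × Fin κ)) (v : V) (φ : V → Fin κ) (y z : V) : Prop :=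
  ∀ c, H.Adj (v, c) (y, φ y) ↔ H.Adj (v, c) (z, φ z)

theorem SameSeen.symm {v : V} {φ : V → Fin κ} {y z : V} (h : SameSeen H v φ y z) :
    SameSeen H v φ z y := fun c => (h c).symm

theorem Stuck.rotate_adj (hs : Stuck G H f D) {v y z : V} {φ : V → Fin κ} (hφ : Holed H f v φ)
    (hvy : G.Adj v y) (hvz : G.Adj v z) (hyz : G.Adj y z) :
    ∃ ψ, Holed H f v ψ ∧ (∀ t, t ≠ v → t ≠ y → t ≠ z → ψ t = φ t) ∧
      H.Adj (y, ψ y) (z, φ z) ∧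
      (∀ c, H.Adj (v, c) (z, ψ z) ↔ H.Adj (v, c) (y, φ y)) ∧
      (∀ c, H.Adj (v, c) (y, ψ y) ↔ H.Adj (v, c) (z, φ z)) := by
  obtain ⟨ψ, h1, h2, h3⟩ := hs.rotate hφ hvy hyz Walk.nil hvz (fun t ht => by
    rw [Walk.support_nil, List.mem_singleton] at ht
    subst ht
    exact ⟨hvz.ne', hyz.ne', fun _ => rfl⟩)
  exact ⟨ψ, h1, fun t ht ht' ht'' => h2 t ht ht' (by simpa using ht''), h3⟩

theorem Stuck.rotate_outside (hs : Stuck G H f D) {v y x x' z : V} {φ : V → Fin κ}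
    (hφ : Holed H f v φ) (hvy : G.Adj v y) (hvz : G.Adj v z) (hyz : y ≠ z) (hyx : G.Adj y x)
    (hj : JoinedOutside G v x x') (hxz : G.Adj x' z) :
    ∃ ψ, Holed H f v ψ ∧
      (∀ t, t ≠ v → t ≠ y → t ≠ z → ¬ JoinedOutside G v x t → ψ t = φ t) ∧
      H.Adj (y, ψ y) (x, φ x) ∧
      (∀ c, H.Adj (v, c) (z, ψ z) ↔ H.Adj (v, c) (y, φ y)) ∧
      (∀ c, H.Adj (v, c) (y, ψ y) ↔ H.Adj (v, c) (z, φ z)) := by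
  obtain ⟨W, hW⟩ := hj
  have hsup : ∀ t, t ∈ (W.concat hxz).support ↔ t ∈ W.support ∨ t = z := fun t => by
    simp [Walk.support_concat]
  obtain ⟨ψ, h1, h2, h3⟩ := hs.rotate hφ hvy hyx (W.concat hxz) hvz (fun t ht => by
    rcases (hsup t).1 ht with h | rfl
    · refine ⟨(hW t h).1, fun hty => (hW t h).2 (hty ▸ hvy), fun h' => ((hW t h).2 h').elim⟩
    · exact ⟨hvz.ne', hyz.symm, fun _ => rfl⟩)
  refine ⟨ψ, h1, fun t ht ht' ht'' hjt => h2 t ht ht' fun hmem => ?_, h3⟩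
  rcases (hsup t).1 hmem with h | h
  · exact hjt (JoinedOutside.of_mem_support hW h)
  · exact ht'' h

/-- Two states that agree at the second vertex of a chordless cycle through the hole see the same
colour at its last vertex. -/
theorem Stuck.seen_determined (hs : Stuck G H f D) {v y x x₁ x₂ z₁ z₂ : V} {φ₁ φ₂ : V → Fin κ}
    (hφ₁ : Holed H f v φ₁) (hφ₂ : Holed H f v φ₂) (hvy : G.Adj v y) (hvz₁ : G.Adj v z₁)
    (hvz₂ : G.Adj v z₂) (hyz₁ : y ≠ z₁) (hyz₂ : y ≠ z₂) (hyx : G.Adj y x)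
    (hj₁ : JoinedOutside G v x x₁) (hxz₁ : G.Adj x₁ z₁)
    (hj₂ : JoinedOutside G v x x₂) (hxz₂ : G.Adj x₂ z₂) (heq : φ₁ x = φ₂ x) (c : Fin κ) :
    H.Adj (v, c) (z₁, φ₁ z₁) ↔ H.Adj (v, c) (z₂, φ₂ z₂) := by
  obtain ⟨ψ₁, -, -, a1, -, b1⟩ := hs.rotate_outside hφ₁ hvy hvz₁ hyz₁ hyx hj₁ hxz₁
  obtain ⟨ψ₂, -, -, a2, -, b2⟩ := hs.rotate_outside hφ₂ hvy hvz₂ hyz₂ hyx hj₂ hxz₂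
  -- After either rotation `y` carries the unique colour matched to the common colour of `x`, and
  -- what sees `y` now is what saw `z₁`, respectively `z₂`, before.
  rw [heq] at a1
  rw [← b1, ← b2, hs.cover.unique a1 a2]

/-- The colours seen at `w` and `y` agree if `w` is linked to `y`, and `y` is attached to
another neighbour `z` of the hole. -/
theorem Stuck.sameSeen_of_third (hs : Stuck G H f D) {v w y z : V} {φ : V → Fin κ}
    (hφ : Holed H f v φ) (hvw : G.Adj v w) (hvy : G.Adj v y) (hvz : G.Adj v z) (hwy : w ≠ y)
    (hwz : w ≠ z) (hyz : y ≠ z) (hat : Attached G v y z)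
    (hlink : G.Adj w y ∨ Attached G v w y) : SameSeen H v φ w y := by
  obtain ⟨x, x', hyx, hj, hxz⟩ := hat
  have hx' := hj.not_adj_right
  have hx'w : x' ≠ w := fun h => hx'.2 (h ▸ hvw)
  have hx'y : x' ≠ y := fun h => hx'.2 (h ▸ hvy)
  -- Exchanging `w` and `y` without touching `x'` keeps what is seen at `y`, since the cycle through
  -- `z` and `x'` determines it. If the path from `w` to `y` lies in the component of `x'`, the two
  -- cycles through `z` and `x'` that end at `w` and `y` are compared directly.
  rcases hlink with h | ⟨t, t', hwt, hjt, hty⟩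
  · obtain ⟨ψ, hψ, h1, -, h2, -⟩ := hs.rotate_adj hφ hvw hvy h
    exact fun c => (h2 c).symm.trans (hs.seen_determined hψ hφ hvz hvy hvy hyz.symm hyz.symm
      hxz.symm hj.symm hyx.symm hj.symm hyx.symm (h1 x' hx'.1 hx'w hx'y) c)
  · by_cases hxt : JoinedOutside G v x' t
    · exact hs.seen_determined hφ hφ hvz hvw hvy hwz.symm hyz.symm hxz.symm hxt hwt.symm
        hj.symm hyx.symm rfl
    · obtain ⟨ψ, hψ, h1, -, h2, -⟩ := hs.rotate_outside hφ hvw hvy hwy hwt hjt hty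
      exact fun c => (h2 c).symm.trans (hs.seen_determined hψ hφ hvz hvy hvy hyz.symm hyz.symm
        hxz.symm hj.symm hyx.symm hj.symm hyx.symm
        (h1 x' hx'.1 hx'w hx'y fun h => hxt h.symm) c)

/-- The colour seeing `w` equals the one seeing `y` both before and after exchanging `y` and `z`; as
`w` keeps its colour, the exchange changes nothing. -/
theorem Stuck.sameSeen_of_attached_aux (hs : Stuck G H f D) {v w y z : V} (hvw : G.Adj v w)
    (hvy : G.Adj v y) (hvz : G.Adj v z) (hwy : w ≠ y) (hwz : w ≠ z) (hyz : y ≠ z)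
    (hat : Attached G v y z) (hlink : G.Adj w y ∨ Attached G v w y) {φ : V → Fin κ}
    (hφ : Holed H f v φ) : SameSeen H v φ y z := by
  have h0 := hs.sameSeen_of_third hφ hvw hvy hvz hwy hwz hyz hat hlink
  obtain ⟨x, x', hyx, hj, hxz⟩ := id hat
  obtain ⟨ψ, hψ, h1, -, -, h2⟩ := hs.rotate_outside hφ hvy hvz hyz hyx hj hxz
  have h3 := hs.sameSeen_of_third hψ hvw hvy hvz hwy hwz hyz hat hlink
  have h4 : ψ w = φ w := h1 w hvw.ne' hwy hwz fun h => h.not_adj_right.2 hvw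
  intro c
  rw [← h2 c, ← h3 c, h4, h0 c]

/-- A third neighbour of `v` exists because `D ≥ 3`. If none were linked to `y` or `z`, the vertex
`v` would separate it from them. -/
theorem Stuck.sameSeen_of_attached (hs : Stuck G H f D) (hD : 3 ≤ D) {v y z : V}
    (hcon : ∀ u w, u ≠ v → w ≠ v → ∃ W : G.Walk u w, v ∉ W.support)
    (hvy : G.Adj v y) (hvz : G.Adj v z) (hyz : y ≠ z)
    (hat : Attached G v y z) {φ : V → Fin κ}
    (hφ : Holed H f v φ) : SameSeen H v φ y z := by
  by_contra hne
  have hnot : ∀ w, G.Adj v w → w ≠ y → w ≠ z →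
      ¬ (G.Adj w y ∨ Attached G v w y) ∧ ¬ (G.Adj w z ∨ Attached G v w z) := by
    intro w hvw hwy hwz
    refine ⟨fun h => hne ?_, fun h => hne ?_⟩
    · exact hs.sameSeen_of_attached_aux hvw hvy hvz hwy hwz hyz hat h hφ
    · exact (hs.sameSeen_of_attached_aux hvw hvz hvy hwz hwy hyz.symm hat.symm h hφ).symm
  obtain ⟨w, hvw, hw⟩ : ∃ w ∈ G.neighborSet v, w ∉ ({y, z} : Set V) := by
    by_contra hno
    push Not at hno
    have h1 := Set.ncard_le_ncard (show G.neighborSet v ⊆ {y, z} from hno) (Set.toFinite _)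
    have h2 := (hs.holed_facts hφ).2.2.2
    have h3 := Set.ncard_pair hyz
    omega
  have := forall_adj_of_linked hcon (fun u => u ≠ y ∧ u ≠ z) (fun p q hp hq _ hP hl => by
    have := hnot p hp hP.1 hP.2
    refine ⟨?_, ?_⟩
    · rintro rfl
      exact this.1 hl
    · rintro rfl
      exact this.2 hl) hvw (by simpa using hw) hvy
  exact this.1 rfl

/-- Agreement with `y` spreads through all links around `v`, for all holed colourings at once; the
common colour `c` then has `f (v, c) = deg v = D`. -/
theorem Stuck.false_of_attached (hs : Stuck G H f D) (hD : 3 ≤ D) (hf : ∀ x, f x < D) {v y z : V}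
    (hcon : ∀ u w, u ≠ v → w ≠ v → ∃ W : G.Walk u w, v ∉ W.support)
    (hvy : G.Adj v y) (hvz : G.Adj v z) (hyz : y ≠ z)
    (hat : Attached G v y z) : False := by
  have hall : ∀ u, G.Adj v u → ∀ φ, Holed H f v φ → SameSeen H v φ u y := by
    intro u hu
    refine forall_adj_of_linked hcon (fun u => ∀ φ, Holed H f v φ → SameSeen H v φ u y)
      (fun p q hp hq hpq hP hl φ hφ => ?_) hvy (fun φ _ c => Iff.rfl) hu
    rcases hl with hl | hl
    · by_cases hqy : q = y
      · exact hqy ▸ fun c => Iff.rfl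
      by_cases hqz : q = z
      · exact hqz ▸ (hs.sameSeen_of_attached hD hcon hvy hvz hyz hat hφ).symm
      -- The exchange carries the colour seeing `q` to `p`, where it is compared with an untouched
      -- vertex: `z` if `p = y`, and `y` otherwise.
      obtain ⟨ψ, hψ, h1, -, h2, h3⟩ := hs.rotate_adj hφ hp hq hl
      intro c
      by_cases hpy : p = y
      · have h4 := hs.sameSeen_of_attached hD hcon hvy hvz hyz hat hψ c
        have h5 := hs.sameSeen_of_attached hD hcon hvy hvz hyz hat hφ c
        subst hpy
        rw [h1 z hvz.ne' hyz.symm (Ne.symm hqz), h3 c] at h4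
        rw [h4, h5]
      · have h4 := hP ψ hψ c
        rwa [h3 c, h1 y hvy.ne' (Ne.symm hpy) (Ne.symm hqy)] at h4
    · exact fun c => ((hs.sameSeen_of_attached hD hcon hp hq hpq hl hφ c).symm).trans (hP φ hφ c)
  obtain ⟨φ, hφ⟩ := hs.exists_holed v
  obtain ⟨h1, h2, -, h3⟩ := hs.holed_facts hφ
  obtain ⟨c, hc⟩ := h2 y hvy
  have h4 : (colorNbrs H φ Finset.univ (v, c) : Set V) = G.neighborSet v := by
    ext w
    simp only [Finset.mem_coe, mem_colorNbrs, Finset.mem_univ, true_and, mem_neighborSet]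
    exact ⟨fun h => hs.cover.adj_base _ _ h, fun h => (hall w h φ hφ c).2 hc⟩
  have h5 := h1 c
  rw [← Set.ncard_coe_finset, h4, h3] at h5
  exact absurd (hf (v, c)) (by omega)

end LocalColors

/-! ### Finding a non-cut vertex with two attached neighbours in a regular graph. -/

section CutVertices

variable {V : Type*} {G : SimpleGraph V}

/-- `u` and `w` are joined by a walk that avoids `x`. -/
def JoinedAvoiding (G : SimpleGraph V) (x u w : V) : Prop := ∃ W : G.Walk u w, x ∉ W.support

theorem JoinedAvoiding.refl {x u : V} (h : u ≠ x) : JoinedAvoiding G x u u :=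
  ⟨Walk.nil, by simpa using h.symm⟩

theorem JoinedAvoiding.symm {x u w : V} (h : JoinedAvoiding G x u w) :
    JoinedAvoiding G x w u := by
  obtain ⟨W, hW⟩ := h
  exact ⟨W.reverse, by simpa using hW⟩

theorem JoinedAvoiding.trans {x u w t : V} (h : JoinedAvoiding G x u w)
    (h' : JoinedAvoiding G x w t) : JoinedAvoiding G x u t := by
  obtain ⟨W, hW⟩ := h
  obtain ⟨W', hW'⟩ := h'
  exact ⟨W.append W', fun h => ((Walk.mem_support_append_iff _ _).1 h).elim hW hW'⟩

theorem JoinedAvoiding.left_ne {x u w : V} (h : JoinedAvoiding G x u w) : u ≠ x := by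
  obtain ⟨W, hW⟩ := h
  exact fun h => hW (h ▸ W.start_mem_support)

theorem JoinedAvoiding.of_adj {x u w : V} (h : G.Adj u w) (hu : u ≠ x) (hw : w ≠ x) :
    JoinedAvoiding G x u w :=
  ⟨h.toWalk, by simpa using ⟨hu.symm, hw.symm⟩⟩

/-- A component of the complement of a closed neighbourhood has two attachments unless a
neighbour separates it. -/
theorem exists_attached_of_not_adj {v w : V} (hG : G.Connected) (hvw : w ≠ v)
    (hadj : ¬ G.Adj v w) (hsep : ∀ y, G.Adj v y → JoinedAvoiding G y w v) :
    ∃ y z, G.Adj v y ∧ G.Adj v z ∧ y ≠ z ∧ Attached G v y z := by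
  have key : ∀ W : G.Walk w v, ∃ x y, JoinedOutside G v w x ∧ G.Adj x y ∧ G.Adj v y ∧
      y ∈ W.support := by
    intro W
    obtain ⟨d, hd, h1, h2⟩ := W.exists_boundary_dart {u | JoinedOutside G v w u}
      (JoinedOutside.refl hvw hadj) (fun h => h.not_adj_right.1 rfl)
    have hdv : d.snd ≠ v := fun h => h1.not_adj_right.2 (h ▸ d.adj.symm)
    refine ⟨d.fst, d.snd, h1, d.adj, ?_, W.dart_snd_mem_support_of_mem_darts hd⟩
    by_contra hna
    exact h2 (JoinedOutside.step h1 d.adj hdv hna)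
  obtain ⟨W⟩ := hG.preconnected w v
  obtain ⟨x, y, hx, hxy, hvy, -⟩ := key W
  -- A walk to `v` avoiding the first attachment `y` must leave the component through a second one.
  obtain ⟨W', hW'⟩ := hsep y hvy
  obtain ⟨x', z, hx', hxz, hvz, hz⟩ := key W'
  exact ⟨y, z, hvy, hvz, fun h => hW' (h ▸ hz), x, x', hxy.symm, hx.symm.trans hx', hxz⟩

/-- A component of the complement of a cut vertex that is smallest over all cut vertices contains
no cut vertex. -/
theorem exists_minimal_cut [Finite V] (hG : G.Connected)
    (hcut : ∃ x k k', k ≠ x ∧ k' ≠ x ∧ ¬ JoinedAvoiding G x k k') :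
    ∃ x k k', k ≠ x ∧ k' ≠ x ∧ ¬ JoinedAvoiding G x k k' ∧
      ∀ v, JoinedAvoiding G x v k → ∀ u w, u ≠ v → w ≠ v → JoinedAvoiding G v u w := by
  classical
  have hex : ∃ n x k k', k ≠ x ∧ k' ≠ x ∧ ¬ JoinedAvoiding G x k k' ∧
      {t | JoinedAvoiding G x t k}.ncard = n := by
    obtain ⟨x, k, k', h1, h2, h3⟩ := hcut
    exact ⟨_, x, k, k', h1, h2, h3, rfl⟩
  obtain ⟨x, k, k', h1, h2, h3, h4⟩ := Nat.find_spec hex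
  refine ⟨x, k, k', h1, h2, h3, fun v hv => ?_⟩
  have hvx := hv.left_ne
  suffices h : ∀ u, u ≠ v → JoinedAvoiding G v u x from
    fun u w hu hw => (h u hu).trans (h w hw).symm
  intro u hu
  by_contra hux
  -- If `v` separates `u` from `x`, the component of `u` in `G - v` misses `x` but is linked to `v`,
  -- so it lies in the component of `v` in `G - x`, without containing `v` itself.
  have hlt : {t | JoinedAvoiding G v t u}.ncard < {t | JoinedAvoiding G x t k}.ncard := by
    refine Set.ncard_lt_ncard ⟨fun t ht => ?_, fun h => (h hv).left_ne rfl⟩ (Set.toFinite _)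
    have htx : ¬ JoinedAvoiding G v t x := fun h => hux (JoinedAvoiding.trans ht.symm h)
    obtain ⟨p, hp⟩ := (hG.preconnected t v).exists_isPath
    refine JoinedAvoiding.trans ⟨p, fun hxp => htx ?_⟩ hv
    exact ⟨p.takeUntil x hxp, Walk.endpoint_notMem_support_takeUntil hp hxp hvx⟩
  exact Nat.find_min hex (h4 ▸ hlt) ⟨v, u, x, hu, hvx.symm, hux, rfl⟩

/-- A connected regular graph that is not complete has a vertex `v` which is not a cut vertex, and
two neighbours of `v` attached to a common component of the complement of the closed
neighbourhood of `v`. -/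
theorem exists_attached_of_regular [Finite V] {D : ℕ} (hG : G.Connected)
    (hreg : ∀ v, (G.neighborSet v).ncard = D) (htop : ∃ a b, a ≠ b ∧ ¬ G.Adj a b) :
    ∃ v y z, (∀ u w, u ≠ v → w ≠ v → JoinedAvoiding G v u w) ∧ G.Adj v y ∧ G.Adj v z ∧ y ≠ z ∧
      Attached G v y z := by
  by_cases hcut : ∃ x k k', k ≠ x ∧ k' ≠ x ∧ ¬ JoinedAvoiding G x k k'
  · obtain ⟨x, k, k', hk, hk', hkk', hmin⟩ := exists_minimal_cut hG hcut
    set K : Set V := {t | JoinedAvoiding G x t k} with hK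
    have hxK : x ∉ K := fun h => h.left_ne rfl
    have hnbr : ∀ v ∈ K, ∀ w, G.Adj v w → w ∈ insert x K := fun v hv w hvw => by
      by_cases hwx : w = x
      · exact Or.inl hwx
      · exact Or.inr ((JoinedAvoiding.of_adj hvw.symm hwx hv.left_ne).trans hv)
    -- Otherwise `insert x K` is a clique: `k` has degree at most `|K|`, while `x` is adjacent to
    -- all of `K` and to a vertex beyond it, contradicting regularity.
    obtain ⟨v, hv, w, hw, hwv, hadj⟩ : ∃ v ∈ K, ∃ w ∈ insert x K, w ≠ v ∧ ¬ G.Adj v w := by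
      by_contra hno
      push Not at hno
      have h1 : (G.neighborSet k).ncard ≤ K.ncard := by
        have hsub : G.neighborSet k ⊆ insert x K \ {k} := fun w hw =>
          ⟨hnbr k (JoinedAvoiding.refl hk) w hw, (G.ne_of_adj hw).symm⟩
        refine (Set.ncard_le_ncard hsub (Set.toFinite _)).trans ?_
        rw [Set.ncard_sdiff_singleton_of_mem (Set.mem_insert_of_mem x (JoinedAvoiding.refl hk)),
          Set.ncard_insert_of_notMem hxK (Set.toFinite _)]
        rfl
      obtain ⟨W⟩ := hG.preconnected k' k
      obtain ⟨d, -, hd1, hd2⟩ := W.exists_boundary_dart (insert x K)ᶜ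
        (fun h => h.elim hk' fun h => hkk' h.symm)
        (fun h => h (Or.inr (JoinedAvoiding.refl hk)))
      rw [Set.mem_compl_iff, not_not] at hd2
      have hdx : d.snd = x := hd2.resolve_right fun h => hd1 (hnbr _ h _ d.adj.symm)
      have h2 : (insert d.fst K).ncard ≤ (G.neighborSet x).ncard := by
        refine Set.ncard_le_ncard ?_ (Set.toFinite _)
        rintro t (rfl | ht)
        · exact hdx ▸ d.adj.symm
        · exact (hno t ht x (Or.inl rfl) ht.left_ne.symm).symm
      rw [Set.ncard_insert_of_notMem (fun h => hd1 (Or.inr h)) (Set.toFinite _), hreg] at h2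
      rw [hreg] at h1
      omega
    obtain ⟨y, z, h⟩ := exists_attached_of_not_adj hG hwv hadj fun y hvy => by
      have hwy : w ≠ y := fun h => hadj (h ▸ hvy)
      rcases hnbr v hv y hvy with rfl | hy
      · exact JoinedAvoiding.trans (hw.resolve_left hwy) hv.symm
      · exact hmin y hy w v hwy hvy.ne
    exact ⟨v, y, z, hmin v hv, h⟩
  · push Not at hcut
    obtain ⟨v, w, hvw, hadj⟩ := htop
    obtain ⟨y, z, h⟩ := exists_attached_of_not_adj hG hvw.symm hadj fun y hvy =>
      hcut y w v (fun h => hadj (h ▸ hvy)) hvy.ne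
    exact ⟨v, y, z, hcut v, h⟩

end CutVertices

/-! ### Complete base graphs, and the conclusion of part (a). -/

section CompleteBase

variable {V : Type*} [Fintype V] [DecidableEq V] {κ : ℕ} {G : SimpleGraph V}
  {H : SimpleGraph (V × Fin κ)} {f : V × Fin κ → ℕ} {D : ℕ}

theorem Stuck.exists_adj_of_ne_zero (hs : Stuck G H f D) {v : V} {φ : V → Fin κ}
    (hφ : Holed H f v φ) {c : Fin κ} (hc : f (v, c) ≠ 0) : ∃ u, H.Adj (v, c) (u, φ u) := by
  rw [← (hs.holed_facts hφ).1 c, Finset.card_ne_zero] at hc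
  obtain ⟨u, hu⟩ := hc
  exact ⟨u, (mem_colorNbrs.1 hu).2⟩

theorem Stuck.ne_zero_of_adj (hs : Stuck G H f D) {v u : V} {φ : V → Fin κ}
    (hφ : Holed H f v φ) {c : Fin κ} (hc : H.Adj (v, c) (u, φ u)) : f (v, c) ≠ 0 := by
  rw [← (hs.holed_facts hφ).1 c, Finset.card_ne_zero]
  exact ⟨u, mem_colorNbrs.2 ⟨Finset.mem_univ u, hc⟩⟩

/-- Start with the hole at `w`, fill it with `b` by sliding to a vertex that `b` sees, then slide on
to `v`, which is adjacent to everything. -/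
theorem Stuck.exists_holed_color (hs : Stuck G H f D) (htop : ∀ a b, a ≠ b → G.Adj a b)
    {w : V} {b : Fin κ} (v : V) (hb : f (w, b) ≠ 0) :
    ∃ φ, Holed H f v φ ∧ φ w = b := by
  obtain ⟨φ, hφ⟩ := hs.exists_holed w
  obtain ⟨u, hu⟩ := hs.exists_adj_of_ne_zero hφ hb
  have hφ1 := hs.slide hφ hu
  by_cases huv : u = v
  · exact ⟨_, huv ▸ hφ1, Function.update_self ..⟩
  · obtain ⟨c, hc⟩ := (hs.holed_facts hφ1).2.1 v (htop _ _ huv)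
    refine ⟨_, hs.slide hφ1 hc, ?_⟩
    rw [Function.update_of_ne (hs.cover.fst_ne hu), Function.update_self]

theorem Stuck.exists_kernel_adj (hs : Stuck G H f D) (htop : ∀ a b, a ≠ b → G.Adj a b)
    {v w : V} {b : Fin κ} (hvw : v ≠ w) (hb : f (w, b) ≠ 0) :
    ∃ c, f (v, c) ≠ 0 ∧ H.Adj (v, c) (w, b) := by
  obtain ⟨φ, hφ, rfl⟩ := hs.exists_holed_color htop v hb
  obtain ⟨c, hc⟩ := (hs.holed_facts hφ).2.1 w (htop _ _ hvw)
  exact ⟨c, hs.ne_zero_of_adj hφ hc, hc⟩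

/-- With the hole at `v` and `w` coloured by `y`, rotating around the triangle `v, u, w` gives `u`
the colour matched to `y`, namely `z`, and makes it seen by the colour of `v` that saw `y`, namely
`x`. -/
theorem Stuck.adj_trans (hs : Stuck G H f D) (htop : ∀ a b, a ≠ b → G.Adj a b)
    {x y z : V × Fin κ} (hy : f y ≠ 0) (hxy : H.Adj x y) (hyz : H.Adj y z) (hxz : x ≠ z) :
    H.Adj x z := by
  obtain ⟨v, c⟩ := x
  obtain ⟨w, b⟩ := y
  obtain ⟨u, d⟩ := z
  have hvw : v ≠ w := hs.cover.fst_ne hxy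
  have hwu : w ≠ u := hs.cover.fst_ne hyz
  have hvu : v ≠ u := fun h => hxz (hs.cover.matching _ _ _ hxy.symm hyz h)
  obtain ⟨φ, hφ, rfl⟩ := hs.exists_holed_color htop v hy
  obtain ⟨ψ, -, -, h1, -, h2⟩ :=
    hs.rotate_adj hφ (htop _ _ hvu) (htop _ _ hvw) (htop _ _ hwu.symm)
  rw [hs.cover.unique h1 hyz.symm] at h2
  exact (h2 c).2 hxy

/-- Both values count coloured neighbours, before and after sliding the hole along `xy`; by
transitivity the two neighbourhoods agree apart from the ends of that edge. -/
theorem Stuck.value_eq_of_adj (hs : Stuck G H f D) (htop : ∀ a b, a ≠ b → G.Adj a b)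
    {x y : V × Fin κ} (hx : f x ≠ 0) (hy : f y ≠ 0) (hxy : H.Adj x y) : f x = f y := by
  obtain ⟨v, c⟩ := x
  obtain ⟨w, b⟩ := y
  have hvw : v ≠ w := hs.cover.fst_ne hxy
  obtain ⟨φ, hφ, rfl⟩ := hs.exists_holed_color htop v hy
  have hφ1 := hs.slide hφ hxy
  have h1 := (hs.holed_facts hφ).1 c
  have h2 := (hs.holed_facts hφ1).1 (φ w)
  have hwm : w ∈ colorNbrs H φ Finset.univ (v, c) :=
    mem_colorNbrs.2 ⟨Finset.mem_univ w, hxy⟩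
  have hvm : v ∈ colorNbrs H (Function.update φ v c) Finset.univ (w, φ w) :=
    mem_colorNbrs.2 ⟨Finset.mem_univ v, by rw [Function.update_self]; exact hxy.symm⟩
  rw [← h1, ← h2, ← Finset.card_erase_add_one hwm, ← Finset.card_erase_add_one hvm]
  congr 2
  ext t
  simp only [Finset.mem_erase, mem_colorNbrs, Finset.mem_univ, true_and]
  constructor
  · rintro ⟨htw, h⟩
    have htv : t ≠ v := (hs.cover.fst_ne h).symm
    refine ⟨htv, ?_⟩
    rw [Function.update_of_ne htv]
    exact hs.adj_trans htop hx hxy.symm h fun h => htw (congrArg Prod.fst h).symm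
  · rintro ⟨htv, h⟩
    rw [Function.update_of_ne htv] at h
    exact ⟨(hs.cover.fst_ne h).symm,
      hs.adj_trans htop hy hxy h fun h => htv (congrArg Prod.fst h).symm⟩

/-- On the kernel, being equal or adjacent is an equivalence relation whose classes meet each fibre
exactly once. The nonzero colours over a fixed `v₀` therefore index the copies. -/
theorem Stuck.exists_kernel_iso (hs : Stuck G H f D) (htop : ∀ a b, a ≠ b → G.Adj a b) :
    ∃ s, Nonempty (kernel H f ≃g completeTilde (Fintype.card V) s) := by
  classical
  obtain ⟨v₀⟩ := hs.connected.nonempty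
  have htrans : ∀ x y z, f y ≠ 0 → (x = y ∨ H.Adj x y) → (y = z ∨ H.Adj y z) →
      (x = z ∨ H.Adj x z) := by
    rintro x y z hy (rfl | hxy) (rfl | hyz)
    · exact Or.inl rfl
    · exact Or.inr hyz
    · exact Or.inr hxy
    · by_cases hxz : x = z
      · exact Or.inl hxz
      · exact Or.inr (hs.adj_trans htop hy hxy hyz hxz)
  have hfst : ∀ x y, x.1 = y.1 → (x = y ∨ H.Adj x y) → x = y := fun x y hxy h =>
    h.resolve_right fun h' => hs.cover.fst_ne h' hxy
  have hcol : ∀ v c d, ((v, c) = (v, d) ∨ H.Adj (v, c) (v, d)) → c = d := fun v c d h =>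
    congrArg Prod.snd (hfst (v, c) (v, d) rfl h)
  have hsymm : ∀ x y, (x = y ∨ H.Adj x y) → (y = x ∨ H.Adj y x) := fun x y h =>
    h.imp Eq.symm fun h => h.symm
  have hex : ∀ x : {x : V × Fin κ | f x ≠ 0}, ∃ c : {c // f (v₀, c) ≠ 0},
      (x.1 = (v₀, c.1) ∨ H.Adj x.1 (v₀, c.1)) := by
    rintro ⟨⟨v, b⟩, hx⟩
    by_cases hv : v₀ = v
    · subst hv
      exact ⟨⟨b, hx⟩, Or.inl rfl⟩
    · obtain ⟨c, hc, h⟩ := hs.exists_kernel_adj htop hv hx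
      exact ⟨⟨c, hc⟩, Or.inr h.symm⟩
  choose g hg using hex
  have hgeq : ∀ x y : {x : V × Fin κ | f x ≠ 0}, g x = g y ↔ (x.1 = y.1 ∨ H.Adj x.1 y.1) := by
    intro x y
    constructor
    · intro h
      exact htrans _ _ _ (g x).2 (hg x) (hsymm _ _ (h ▸ hg y))
    · intro h
      have h1 := htrans _ _ _ x.2 (hsymm _ _ (hg x)) (htrans _ _ _ y.2 h (hg y))
      exact Subtype.ext (hcol _ _ _ h1)
  let e := Fintype.equivFin V
  let es := Fintype.equivFin {c // f (v₀, c) ≠ 0}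
  refine ⟨_, ⟨⟨Equiv.ofBijective (fun x => (e x.1.1, es (g x))) ⟨?_, ?_⟩, ?_⟩⟩⟩
  · intro x y hxy
    simp only [Prod.mk.injEq, EmbeddingLike.apply_eq_iff_eq] at hxy
    exact Subtype.ext (hfst _ _ hxy.1 ((hgeq x y).1 hxy.2))
  · rintro ⟨i, j⟩
    obtain ⟨v, rfl⟩ := e.surjective i
    obtain ⟨⟨c, hc⟩, rfl⟩ := es.surjective j
    obtain ⟨x, hxv, hx⟩ : ∃ x : {x : V × Fin κ | f x ≠ 0}, x.1.1 = v ∧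
        ((v₀, c) = x.1 ∨ H.Adj (v₀, c) x.1) := by
      by_cases hv : v = v₀
      · exact ⟨⟨(v₀, c), hc⟩, hv.symm, Or.inl rfl⟩
      · obtain ⟨d, hd, h⟩ := hs.exists_kernel_adj htop hv hc
        exact ⟨⟨(v, d), hd⟩, rfl, Or.inr h.symm⟩
    refine ⟨x, ?_⟩
    have h1 := hcol _ _ _ (htrans _ _ _ x.2 hx (hg x))
    have h2 : g x = ⟨c, hc⟩ := Subtype.ext h1.symm
    simp only [hxv, h2]
  · intro x y
    have hxy : (kernel H f).Adj x y ↔ H.Adj x.1 y.1 := Iff.rfl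
    rw [hxy]
    simp only [completeTilde, boxProd_adj, completeGraph, top_adj,
      bot_adj, false_and, or_false, ne_eq]
    constructor
    · rintro ⟨h1, h2⟩
      exact ((hgeq x y).1 (es.injective h2)).resolve_left fun h => h1 (congrArg (fun x : V × Fin κ => e x.1) h)
    · intro h
      exact ⟨fun h' => hs.cover.fst_ne h (e.injective h'),
        congrArg es ((hgeq x y).2 (Or.inr h))⟩

theorem ncard_neighborSet_eq_degree [DecidableRel G.Adj] (v : V) :
    (G.neighborSet v).ncard = G.degree v := by
  rw [Set.ncard_eq_toFinset_card']
  rfl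

theorem Stuck.isBuildingCover [DecidableRel G.Adj] (hs : Stuck G H f D)
    (htop : ∀ a b, a ≠ b → G.Adj a b) : IsBuildingCover G H f := by
  have hfacts : ∀ v, ∑ c, f (v, c) = D ∧ (G.neighborSet v).ncard = D := fun v => by
    obtain ⟨φ, hφ⟩ := hs.exists_holed v
    exact (hs.holed_facts hφ).2.2
  refine ⟨hs.cover, fun v => ?_, Or.inr (Or.inl ?_)⟩
  · rw [(hfacts v).1, ← (hfacts v).2, ncard_neighborSet_eq_degree]
  · obtain ⟨s, hiso⟩ := hs.exists_kernel_iso htop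
    refine ⟨Fintype.card V, s, ?_, ⟨⟨Fintype.equivFin V, ?_⟩⟩, hiso, ?_⟩
    · obtain ⟨v⟩ := hs.connected.nonempty
      obtain ⟨w, hw⟩ := (Set.ncard_pos (Set.toFinite _)).1 ((hfacts v).2.symm ▸ hs.pos)
      exact Fintype.one_lt_card_iff.2 ⟨v, w, G.ne_of_adj hw⟩
    · intro a b
      simp only [completeGraph, top_adj, ne_eq, EmbeddingLike.apply_eq_iff_eq]
      exact ⟨htop a b, fun h => h.ne⟩
    · rintro x y ⟨W⟩
      induction W with
      | nil => rfl
      | @cons x y _ h W ih => exact (hs.value_eq_of_adj htop x.2 y.2 h).trans ih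

/-- A connected graph of maximum degree at least three has a strictly degenerate transversal in
every valued cover that is not a building cover of a complete graph. -/
theorem exists_degenerateOn_univ [DecidableRel G.Adj] (hG : G.Connected) (hD : 3 ≤ G.maxDegree)
    (hc : IsCover G H) (hf : ∀ x, f x < G.maxDegree) (hsum : ∀ v, G.maxDegree ≤ ∑ q, f (v, q))
    (hno : ¬ (IsBuildingCover G H f ∧
      Nonempty (G ≃g completeGraph (Fin (G.maxDegree + 1))))) :
    ∃ φ, DegenerateOn H f Finset.univ φ := by
  by_contra hcon
  push Not at hcon
  have hs : Stuck G H f G.maxDegree :=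
    ⟨by omega, hc, hG, fun v => (ncard_neighborSet_eq_degree v).trans_le (G.degree_le_maxDegree v), hsum, hcon⟩
  have hreg : ∀ v, (G.neighborSet v).ncard = G.maxDegree := fun v => by
    obtain ⟨φ, hφ⟩ := hs.exists_holed v
    exact (hs.holed_facts hφ).2.2.2
  by_cases htop : ∀ a b, a ≠ b → G.Adj a b
  · refine hno ⟨hs.isBuildingCover htop, ?_⟩
    obtain ⟨v⟩ := hG.nonempty
    have hset : G.neighborSet v = Set.univ \ {v} := by
      ext w
      simp only [mem_neighborSet, Set.mem_sdiff, Set.mem_univ, true_and, Set.mem_singleton_iff]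
      exact ⟨fun h => h.ne', fun h => htop _ _ (Ne.symm h)⟩
    have hcard : Fintype.card V = G.maxDegree + 1 := by
      rw [← hreg v, hset, Set.ncard_sdiff_singleton_add_one (Set.mem_univ v) (Set.toFinite _),
        Set.ncard_univ, Nat.card_eq_fintype_card]
    refine ⟨⟨Fintype.equivFinOfCardEq hcard, ?_⟩⟩
    intro a b
    simp only [completeGraph, top_adj, ne_eq, EmbeddingLike.apply_eq_iff_eq]
    exact ⟨htop a b, fun h => h.ne⟩
  · push Not at htop
    obtain ⟨v, y, z, hv, hvy, hvz, hyz, hat⟩ := exists_attached_of_regular hG hreg htop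
    exact hs.false_of_attached hD hf hv hvy hvz hyz hat

theorem DegenerateOn.isStrictlyDegenerateTransversal {φ : V → Fin κ}
    (hφ : DegenerateOn H f Finset.univ φ) :
    IsStrictlyDegenerateTransversal H f {x | x.2 = φ x.1} := by
  classical
  refine ⟨fun v => ⟨φ v, rfl, fun q hq => hq⟩, fun S ⟨x, hx⟩ => ?_⟩
  have hmem : ∀ v, (v, φ v) ∈ {x : V × Fin κ | x.2 = φ x.1} := fun v => rfl
  -- Passing from `S` to the full induced subgraph on its vertices only raises degrees, so
  -- `DegenerateOn`, which tests induced subgraphs, suffices.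
  let T : Finset V := Finset.univ.filter fun v => (⟨(v, φ v), hmem v⟩ : {x : V × Fin κ | x.2 = φ x.1}) ∈ S.verts
  have hT : ∀ y ∈ S.verts, y.1.1 ∈ T ∧ y = ⟨(y.1.1, φ y.1.1), hmem _⟩ := fun y hy => by
    have hy' : y = ⟨(y.1.1, φ y.1.1), hmem _⟩ := Subtype.ext (Prod.ext rfl y.2)
    refine ⟨Finset.mem_filter.2 ⟨Finset.mem_univ _, ?_⟩, hy'⟩
    rw [← hy']
    exact hy
  obtain ⟨u, hu, hlt⟩ := hφ T (Finset.subset_univ _) ⟨_, (hT x hx).1⟩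
  refine ⟨⟨(u, φ u), hmem u⟩, (Finset.mem_filter.1 hu).2, lt_of_le_of_lt ?_ (Nat.cast_lt.2 hlt)⟩
  rw [← Set.encard_coe_eq_coe_finsetCard]
  refine (Set.encard_le_encard_of_injOn (f := fun y => y.1.1) (fun y hy => ?_) ?_)
  · have h1 := hT y (S.edge_vert hy.symm)
    have h2 : H.Adj (u, φ u) y.1 := S.adj_sub hy
    rw [h1.2] at h2
    exact mem_colorNbrs.2 ⟨h1.1, h2⟩
  · intro y hy z hz hyz
    rw [(hT y (S.edge_vert hy.symm)).2, (hT z (S.edge_vert hz.symm)).2]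
    simp only at hyz
    simp only [hyz]

end CompleteBase

/-! ### List colourings as transversals, and part (b) for maximum degree at least three. -/

section LinearForests

variable {V : Type*} [Fintype V] [DecidableEq V] {κ : ℕ} {G : SimpleGraph V}
  {H : SimpleGraph (V × Fin κ)} {f : V × Fin κ → ℕ}

/-- The cover whose transversals are colourings: two vertices are adjacent if they lie over
adjacent vertices and have the same colour. -/
def listCover (G : SimpleGraph V) (κ : ℕ) : SimpleGraph (V × Fin κ) where
  Adj x y := G.Adj x.1 y.1 ∧ x.2 = y.2
  symm := ⟨fun _ _ h => ⟨h.1.symm, h.2.symm⟩⟩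
  loopless := ⟨fun _ h => h.1.ne rfl⟩

theorem isCover_listCover : IsCover G (listCover G κ) :=
  ⟨fun _ _ h => h.1, fun _ _ _ h h' hyz => Prod.ext hyz (h.2.symm.trans h'.2)⟩

open Classical in
/-- The pairs of vertices in `T` whose colours are adjacent in the cover. -/
noncomputable def adjPairs (H : SimpleGraph (V × Fin κ)) (φ : V → Fin κ) (T : Finset V) :
    Finset (V × V) :=
  (T ×ˢ T).filter fun p => H.Adj (p.1, φ p.1) (p.2, φ p.2)

/-- Pairs are ordered, so each edge at `v` contributes two. This isolates the effect of recolouring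
`v` on the number of edges. -/
theorem card_adjPairs (hc : IsCover G H) (φ : V → Fin κ) (v : V) :
    (adjPairs H φ Finset.univ).card = (adjPairs H φ (Finset.univ.erase v)).card +
      2 * (colorNbrs H φ Finset.univ (v, φ v)).card := by
  set A := colorNbrs H φ Finset.univ (v, φ v) with hA
  have hvA : v ∉ A := fun h => hc.fst_ne (mem_colorNbrs.1 h).2 rfl
  have h1 : adjPairs H φ Finset.univ =
      adjPairs H φ (Finset.univ.erase v) ∪ (A ×ˢ {v} ∪ {v} ×ˢ A) := by
    ext ⟨a, b⟩
    simp only [adjPairs, Finset.mem_union, Finset.mem_filter, Finset.mem_product,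
      Finset.mem_univ, Finset.mem_erase, Finset.mem_singleton, hA, mem_colorNbrs, true_and,
      and_true, ne_eq]
    constructor
    · intro h
      by_cases ha : a = v
      · exact Or.inr (Or.inr ⟨ha, ha ▸ h⟩)
      · by_cases hb : b = v
        · exact Or.inr (Or.inl ⟨hb ▸ h.symm, hb⟩)
        · exact Or.inl ⟨⟨ha, hb⟩, h⟩
    · rintro (⟨-, h⟩ | ⟨h, rfl⟩ | ⟨rfl, h⟩)
      exacts [h, h.symm, h]
  have h2 : Disjoint (A ×ˢ {v}) ({v} ×ˢ A) := by
    refine Finset.disjoint_left.2 ?_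
    rintro ⟨a, b⟩ h h'
    simp only [Finset.mem_product, Finset.mem_singleton] at h h'
    exact hvA (h'.1 ▸ h.1)
  have h3 : Disjoint (adjPairs H φ (Finset.univ.erase v)) (A ×ˢ {v} ∪ {v} ×ˢ A) := by
    refine Finset.disjoint_left.2 ?_
    rintro ⟨a, b⟩ h h'
    simp only [adjPairs, Finset.mem_union, Finset.mem_filter, Finset.mem_product,
      Finset.mem_univ, Finset.mem_erase, Finset.mem_singleton, and_true] at h h'
    rcases h' with h' | h'
    exacts [h.1.2 h'.2, h.1.1 h'.1]
  rw [h1, Finset.card_union_of_disjoint h3, Finset.card_union_of_disjoint h2,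
    Finset.card_product, Finset.card_product, Finset.card_singleton]
  omega

theorem adjPairs_congr {φ ψ : V → Fin κ} {T : Finset V} (h : ∀ w ∈ T, ψ w = φ w) :
    adjPairs H ψ T = adjPairs H φ T := by
  ext ⟨a, b⟩
  simp only [adjPairs, Finset.mem_filter, Finset.mem_product]
  exact and_congr_right fun hab => by rw [h a hab.1, h b hab.2]

/-- If `f ≤ 2`, then a strictly degenerate transversal spanning as few edges as possible spans a
graph of maximum degree at most two. -/
theorem exists_degenerateOn_card_le_two [DecidableRel G.Adj] (hc : IsCover G H)
    (hf : ∀ x, f x ≤ 2) (hsum : ∀ v, G.degree v ≤ ∑ q, f (v, q))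
    (hex : ∃ φ, DegenerateOn H f Finset.univ φ) :
    ∃ φ, DegenerateOn H f Finset.univ φ ∧
      ∀ v, (colorNbrs H φ Finset.univ (v, φ v)).card ≤ 2 := by
  classical
  obtain ⟨φ, hφ, hmin⟩ := Finset.exists_min_image
    (Finset.univ.filter fun φ => DegenerateOn H f Finset.univ φ)
    (fun φ => (adjPairs H φ Finset.univ).card)
    (hex.imp fun φ hφ => Finset.mem_filter.2 ⟨Finset.mem_univ _, hφ⟩)
  have hφ := (Finset.mem_filter.1 hφ).2
  refine ⟨φ, hφ, fun v => not_lt.1 fun hlt => ?_⟩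
  -- The present colour of `v` has more than `2 ≥ f` neighbours and the counts sum to at most `deg v
  -- ≤ ∑ f`, so another colour has slack. Recolouring with it stays degenerate and leaves at most
  -- one edge at `v`, contradicting minimality.
  obtain ⟨c, hcv⟩ : ∃ c, (colorNbrs H φ Finset.univ (v, c)).card < f (v, c) := by
    by_contra hno
    push Not at hno
    have h1 := Finset.sum_lt_sum (fun c (_ : c ∈ Finset.univ) => hno c)
      ⟨φ v, Finset.mem_univ _, (hf _).trans_lt hlt⟩
    have h2 := (sum_card_colorNbrs_le hc φ Finset.univ v).trans_eq
      (show _ = G.degree v by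
        rw [← card_neighborFinset_eq_degree]
        congr 1
        ext w
        simp)
    have h4 := hsum v
    omega
  have hdeg : DegenerateOn H f Finset.univ (Function.update φ v c) :=
    Holed.degenerateOn_update hc (hφ.mono (Finset.subset_univ _)) hcv
  have h1 := hmin _ (Finset.mem_filter.2 ⟨Finset.mem_univ _, hdeg⟩)
  rw [card_adjPairs hc φ v, card_adjPairs hc (Function.update φ v c) v,
    adjPairs_congr (φ := φ) (ψ := Function.update φ v c) (T := Finset.univ.erase v)
      fun w hw => Function.update_of_ne (Finset.ne_of_mem_erase hw) _ _,
    Function.update_self, colorNbrs_update hc] at h1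
  have h2 := hf (v, c)
  omega

/-- On a monochromatic cycle every vertex would have at least two neighbours of its own colour, but
strict degeneracy with `f ≤ 2` gives one with at most one. -/
theorem isLinearForestedColoring_of_degenerateOn {φ : V → Fin κ} (hf : ∀ x, f x ≤ 2)
    (hφ : DegenerateOn (listCover G κ) f Finset.univ φ)
    (hcard : ∀ v, (colorNbrs (listCover G κ) φ Finset.univ (v, φ v)).card ≤ 2) :
    IsLinearForestedColoring G fun v => (φ v : ℕ) := by
  classical
  intro c
  have hcol : ∀ x y : {v | (φ v : ℕ) = c}, φ x.1 = φ y.1 := fun x y =>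
    Fin.ext (x.2.trans y.2.symm)
  refine ⟨fun x p hp => ?_, fun x => ?_⟩
  · obtain ⟨u, hu, hlt⟩ := hφ (p.support.toFinset.image Subtype.val) (Finset.subset_univ _)
      ⟨x.1, Finset.mem_image_of_mem _ (by simp)⟩
    obtain ⟨w, hw, rfl⟩ := Finset.mem_image.1 hu
    have h1 := hp.ncard_neighborSet_toSubgraph_eq_two (List.mem_toFinset.1 hw)
    have h2 : (p.toSubgraph.neighborSet w).ncard ≤
        (colorNbrs (listCover G κ) φ (p.support.toFinset.image Subtype.val)
          (w.1, φ w.1)).card := by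
      rw [← Set.ncard_coe_finset]
      refine Set.ncard_le_ncard_of_injOn Subtype.val (fun y hy => ?_)
        Subtype.val_injective.injOn (Set.toFinite _)
      refine mem_colorNbrs.2 ⟨Finset.mem_image_of_mem _ ?_, p.toSubgraph.adj_sub hy, hcol w y⟩
      rw [List.mem_toFinset, ← Walk.mem_verts_toSubgraph]
      exact p.toSubgraph.edge_vert (p.toSubgraph.adj_symm hy)
    have h3 := hf (w.1, φ w.1)
    omega
  · refine le_trans (Set.encard_le_encard_of_injOn (f := Subtype.val)
      (t := colorNbrs (listCover G κ) φ Finset.univ (x.1, φ x.1)) (fun y hy => ?_)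
      Subtype.val_injective.injOn) ?_
    · exact mem_colorNbrs.2 ⟨Finset.mem_univ _, hy, hcol x y⟩
    · rw [Set.encard_coe_eq_coe_finsetCard]
      exact_mod_cast hcard x.1

theorem linearListForestedColorable_of_three_le_maxDegree [DecidableRel G.Adj]
    (hG : G.Connected) (hD : 3 ≤ G.maxDegree) (hodd : ¬ (G = ⊤ ∧ Odd (Fintype.card V))) {k : ℕ}
    (hk : G.maxDegree ≤ 2 * k) : LinearListForestedColorable G k := by
  classical
  intro L hL
  obtain ⟨N, hN⟩ : ∃ N, ∀ v, ∀ c ∈ L v, c < N :=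
    ⟨Finset.univ.sup (fun v => (L v).sup id) + 1, fun v c hc => Nat.lt_succ_of_le
      ((Finset.le_sup (f := id) hc).trans
        (Finset.le_sup (f := fun v => (L v).sup id) (Finset.mem_univ v)))⟩
  let f : V × Fin N → ℕ := fun x => if x.2 ∈ (L x.1).attachFin (hN x.1) then 2 else 0
  have hf : ∀ x, f x ≤ 2 := fun x => by
    simp only [f]
    split_ifs <;> omega
  have hsum : ∀ v, ∑ q, f (v, q) = 2 * (L v).card := fun v => by
    simp only [f]
    rw [← Finset.sum_filter, Finset.sum_const, smul_eq_mul, mul_comm,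
      ← Finset.card_attachFin (L v) (hN v)]
    congr 2
    ext q
    simp
  have hsum' : ∀ v, G.maxDegree ≤ ∑ q, f (v, q) := fun v => by
    rw [hsum]
    have := hL v
    omega
  obtain ⟨φ, hφ, hcard⟩ := exists_degenerateOn_card_le_two (f := f) isCover_listCover hf
    (fun v => (G.degree_le_maxDegree v).trans (hsum' v))
    -- In the exceptional case `Δ = ∑ f = 2 * (L v).card` is even, so the complete graph on `Δ + 1`
    -- vertices has odd order.
    (exists_degenerateOn_univ hG hD isCover_listCover (fun x => (hf x).trans_lt hD) hsum' (by
      rintro ⟨hb, ⟨e⟩⟩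
      have htop : G = ⊤ := by
        ext a b
        rw [← e.map_adj_iff]
        simp [completeGraph]
      have hcard : Fintype.card V = G.maxDegree + 1 := by
        rw [Fintype.card_congr e.toEquiv, Fintype.card_fin]
      obtain ⟨v⟩ := hG.nonempty
      have h1 := hb.2.1 v
      have h2 : G.degree v = G.maxDegree :=
        le_antisymm (G.degree_le_maxDegree v) (h1 ▸ hsum' v)
      rw [hsum, h2] at h1
      exact hodd ⟨htop, (L v).card, by omega⟩))
  refine ⟨fun v => φ v, fun v => ?_, isLinearForestedColoring_of_degenerateOn hf hφ hcard⟩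
  have hpos := hφ.pos (Finset.mem_univ v)
  by_contra hv
  simp [f, hv] at hpos

end LinearForests

/-! ### Maximum degree at most two. -/

section SmallDegree

variable {V : Type*} [Fintype V] {G : SimpleGraph V} [DecidableRel G.Adj]

/-- The vertices of a cycle in `G` already have their full degree two on it, so by connectedness the
cycle is all of `G`. -/
theorem isAcyclic_of_maxDegree_le_two (hG : G.Connected) (hD : G.maxDegree ≤ 2)
    (hcyc : ¬ ∃ n : ℕ, 3 ≤ n ∧ Nonempty (G ≃g cycleGraph n)) : G.IsAcyclic := by
  classical
  by_contra hac
  rw [isAcyclic_iff_free_cycleGraph] at hac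
  push Not at hac
  obtain ⟨n, hn, ⟨φ⟩⟩ := hac
  refine hcyc ⟨n, hn, ?_⟩
  obtain ⟨m, rfl⟩ := Nat.exists_eq_add_of_le' hn
  have hnbr : ∀ i w, G.Adj (φ i) w → ∃ j, φ j = w ∧ (cycleGraph (m + 3)).Adj i j := by
    intro i w hw
    have hsub : ((cycleGraph (m + 3)).neighborFinset i).image φ ⊆ G.neighborFinset (φ i) := by
      intro u hu
      obtain ⟨j, hj, rfl⟩ := Finset.mem_image.1 hu
      rw [mem_neighborFinset] at hj ⊢
      exact φ.toHom.map_adj hj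
    have heq := Finset.eq_of_subset_of_card_le hsub (by
      rw [Finset.card_image_of_injective (f := φ) _ φ.injective, card_neighborFinset_eq_degree,
        card_neighborFinset_eq_degree, cycleGraph_degree_three_le]
      exact (G.degree_le_maxDegree _).trans hD)
    have hw' : w ∈ G.neighborFinset (φ i) := (mem_neighborFinset ..).2 hw
    rw [← heq] at hw'
    obtain ⟨j, hj, rfl⟩ := Finset.mem_image.1 hw'
    exact ⟨j, rfl, (mem_neighborFinset ..).1 hj⟩
  have hsurj : Function.Surjective φ := by
    intro w
    by_contra hw
    obtain ⟨W⟩ := hG.preconnected (φ 0) w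
    obtain ⟨d, -, ⟨i, hi⟩, h2⟩ := W.exists_boundary_dart (Set.range φ) ⟨0, rfl⟩ hw
    obtain ⟨j, hj, -⟩ := hnbr i d.snd (hi ▸ d.adj)
    exact h2 ⟨j, hj⟩
  refine ⟨Iso.symm ⟨Equiv.ofBijective φ ⟨φ.injective, hsurj⟩, ?_⟩⟩
  intro i j
  refine ⟨fun h => ?_, fun h => φ.toHom.map_adj h⟩
  obtain ⟨j', hj', hadj⟩ := hnbr i _ h
  exact φ.injective hj' ▸ hadj

theorem linearListForestedColorable_of_isAcyclic (hac : G.IsAcyclic) (hD : G.maxDegree ≤ 2)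
    {k : ℕ} (hk : 1 ≤ k) : LinearListForestedColorable G k := by
  intro L hL
  choose φ hφ using fun v => Finset.card_pos.1 (hk.trans (hL v))
  refine ⟨φ, hφ, fun c => ⟨hac.induce _, fun v => ?_⟩⟩
  refine le_trans (Set.encard_le_encard_of_injOn (f := Subtype.val) (t := G.neighborFinset v.1)
    (fun y hy => ?_) Subtype.val_injective.injOn) ?_
  · exact Finset.mem_coe.2 ((mem_neighborFinset ..).2 hy)
  · rw [Set.encard_coe_eq_coe_finsetCard]
    exact_mod_cast (G.degree_le_maxDegree v.1).trans hD

theorem eq_top_and_card_of_maxDegree_eq_zero (hG : G.Connected) (hD : G.maxDegree = 0) :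
    G = ⊤ ∧ Odd (Fintype.card V) := by
  have hsub : ∀ a b : V, a = b := fun a b => by
    by_contra hab
    obtain ⟨u, hu, -⟩ := exists_adj_dist_lt hG hab
    have := (G.degree_pos_iff_exists_adj a).2 ⟨u, hu⟩
    have := G.degree_le_maxDegree a
    omega
  have : Subsingleton V := ⟨hsub⟩
  obtain ⟨v⟩ := hG.nonempty
  exact ⟨Subsingleton.elim _ _, by rw [Fintype.card_eq_one_iff.2 ⟨v, fun b => hsub b v⟩]; simp⟩

end SmallDegree

end CoverDegeneracy

theorem mainTheorem9 {V : Type*} [Fintype V] (G : SimpleGraph V) [DecidableRel G.Adj]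
    (hG : G.Connected) :
    (3 ≤ G.maxDegree →
      ∀ (κ : ℕ) (H : SimpleGraph (V × Fin κ)) (f : V × Fin κ → ℕ),
        CoverDegeneracy.IsCover G H →
        (∀ x, f x < G.maxDegree) →
        (∀ v, G.maxDegree ≤ ∑ q, f (v, q)) →
        ¬ (CoverDegeneracy.IsBuildingCover G H f ∧
            Nonempty (G ≃g SimpleGraph.completeGraph (Fin (G.maxDegree + 1)))) →
        ∃ R : Set (V × Fin κ), CoverDegeneracy.IsStrictlyDegenerateTransversal H f R) ∧
    (¬ (G = ⊤ ∧ Odd (Fintype.card V)) →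
      ¬ (∃ n : ℕ, 3 ≤ n ∧ Nonempty (G ≃g SimpleGraph.cycleGraph n)) →
      CoverDegeneracy.linearListVertexArboricity G ≤ (⌈(G.maxDegree : ℚ) / 2⌉₊ : ℕ)) := by
  classical
  refine ⟨fun hD κ H f hc hf hsum hno => ?_, fun hodd hcyc => ?_⟩
  · obtain ⟨φ, hφ⟩ := CoverDegeneracy.exists_degenerateOn_univ hG hD hc hf hsum hno
    exact ⟨_, hφ.isStrictlyDegenerateTransversal⟩
  · have hk : G.maxDegree ≤ 2 * ⌈(G.maxDegree : ℚ) / 2⌉₊ := by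
      have := Nat.le_ceil ((G.maxDegree : ℚ) / 2)
      have h : (G.maxDegree : ℚ) ≤ 2 * (⌈(G.maxDegree : ℚ) / 2⌉₊ : ℚ) := by linarith
      exact_mod_cast h
    refine iInf₂_le _ ?_
    by_cases hD : 3 ≤ G.maxDegree
    · exact CoverDegeneracy.linearListForestedColorable_of_three_le_maxDegree hG hD hodd hk
    · have hD' : G.maxDegree ≤ 2 := by omega
      -- Degree zero would make the bound `0`, which no nonempty graph attains; the only such
      -- connected graph is `K₁`, complete of odd order.
      have hpos : G.maxDegree ≠ 0 := fun h =>
        hodd (CoverDegeneracy.eq_top_and_card_of_maxDegree_eq_zero hG h)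
      exact CoverDegeneracy.linearListForestedColorable_of_isAcyclic
        (CoverDegeneracy.isAcyclic_of_maxDegree_le_two hG hD' hcyc) hD' (by omega)
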